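/- Let $M$ be a compact smooth Riemannian manifold without boundary, let $\Omega$ be a compact metric space, and let $\omega\mapsto f_\omega$ be a continuous map from $\Omega$ to the space $\mathrm{Diff}^2(M)$ of $C^2$ diffeomorphisms of $M$ with the $C^2$ topology. Let $G:\Omega^{\mathbb Z}\times M\to\Omega^{\mathbb Z}\times M$ be the homeomorphism $$G(\underline\omega,x)=(\sigma(\underline\omega),f_{\omega_0}(x)),$$ where $\sigma$ is the left shift. Attach to each point $(\underline\omega,x)$ the tangent space $T_xM$, and let $DG$ act on the resulting bundle by $DG(v)=Df_{\omega_0}(v)$ for $v\in T_xM$ over $(\underline\omega,x)$; this action is invertible, and $DG^{-k}$ denotes the $k$-th iterate of its inverse. Let $\Lambda^G\subset\Omega^{\mathbb Z}\times M$ be a compact set with $G(\Lambda^G)=\Lambda^G$, and let $E$ be a continuous one-dimensional sub-bundle of the tangent bundle over $\Lambda^G$ that is $DG$-invariant, i.e. $DG(E(p))=E(G(p))$ for all $p\in\Lambda^G$. For an integer $\ell\ge 1$ and $\alpha>0$ put $$\Lambda^G_\ell(E,\alpha)=\Big\{p\in\Lambda^G:\ \prod_{i=0}^{n-1}\big\|DG^{-\ell}|_{E(G^{-i\ell}(p))}\big\|\le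 e^{-\alpha\ell n}\ \text{ for all } n\in\mathbb N\Big\}.$$ Let $\eta$ be a $G$-invariant Borel probability measure supported on $\Lambda^G$, and let $\theta>\alpha>0$ be constants such that $\int\log\|DG|_E\|\,d\zeta>\theta$ for ($\eta$-almost) every ergodic component $\zeta$ of $\eta$. Let $(\eta_n)_{n\in\mathbb N}$ be a sequence of ergodic $G$-invariant Borel probability measures supported on $\Lambda^G$ that converges to $\eta$ in the weak-$*$ topology. Then for every $\varepsilon>0$ there is an integer $\ell=\ell(\varepsilon)\ge 1$ such that $$\liminf_{n\to\infty}\eta_n\big(\Lambda^G_\ell(E,\alpha)\big)>1-\varepsilon .$$ -/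

import Mathlib

open MeasureTheory ProbabilityTheory Filter Topology Manifold Bundle
open scoped ContDiff

noncomputable section

/-- The group `Diff²(M)` of `C²` diffeomorphisms of a manifold `M` of dimension `d`. -/
abbrev DiffTwo (d : ℕ) (M : Type*) [TopologicalSpace M]
    [ChartedSpace (EuclideanSpace ℝ (Fin d)) M] : Type _ :=
  Diffeomorph (𝓡 d) (𝓡 d) M M 2

/-- The second tangent bundle `T(TM)`. -/
abbrev SecondTangentBundle (d : ℕ) (M : Type*) [TopologicalSpace M]
    [ChartedSpace (EuclideanSpace ℝ (Fin d)) M] [IsManifold (𝓡 d) ∞ M] : Type _ :=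
  TangentBundle (𝓡 d).tangent (TangentBundle (𝓡 d) M)

/-- The second tangent map `TTg : TTM → TTM` of a `C²` diffeomorphism `g` of `M`, as a continuous
map. -/
def secondTangentMap {d : ℕ} {M : Type*} [TopologicalSpace M]
    [ChartedSpace (EuclideanSpace ℝ (Fin d)) M] [IsManifold (𝓡 d) ∞ M] (g : DiffTwo d M) :
    C(SecondTangentBundle d M, SecondTangentBundle d M) where
  toFun := tangentMap (𝓡 d).tangent (𝓡 d).tangent (tangentMap (𝓡 d) (𝓡 d) g)
  continuous_toFun :=
    (g.contMDiff.contMDiff_tangentMap (m := 1) (by norm_num)).continuous_tangentMap le_rfl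

/-- The `C²` topology on `Diff²(M)`: the initial topology for `g ↦ TTg`, where the space of
continuous maps `TTM → TTM` carries the compact-open topology. In charts, `TTg` is
`(x, u, v, w) ↦ (g x, Dg(x) u, Dg(x) v, D²g(x)(u, v) + Dg(x) w)`, so this is the topology of locally
uniform convergence, in charts, of `g` and of its derivatives of order at most two. -/
instance diffTwoTopology {d : ℕ} {M : Type*} [TopologicalSpace M]
    [ChartedSpace (EuclideanSpace ℝ (Fin d)) M] [IsManifold (𝓡 d) ∞ M] :
    TopologicalSpace (DiffTwo d M) :=
  TopologicalSpace.induced secondTangentMap inferInstance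

/-- The extended dynamical system `G` on `Ω^ℤ × M` generated by the family `f : Ω → Diff²(M)`:
`G (ω, x) = (σ ω, f_{ω₀}(x))`, where `σ` is the left shift. It is invertible, with inverse
`(ω, x) ↦ (σ⁻¹ ω, (f_{ω₋₁})⁻¹(x))`. -/
def extSystem {d : ℕ} {Ω M : Type*} [TopologicalSpace M]
    [ChartedSpace (EuclideanSpace ℝ (Fin d)) M]
    (f : Ω → DiffTwo d M) : ((ℤ → Ω) × M) ≃ ((ℤ → Ω) × M) where
  toFun p := (fun i => p.1 (i + 1), f (p.1 0) p.2)
  invFun p := (fun i => p.1 (i - 1), (f (p.1 (-1))).symm p.2)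
  left_inv p := by simp
  right_inv p := by simp

/-- The action `DG` on tangent vectors: at `p = (ω, x)` it is `Df_{ω₀}(x)`. -/
def extTangent {d : ℕ} {Ω M : Type*} [TopologicalSpace M]
    [ChartedSpace (EuclideanSpace ℝ (Fin d)) M]
    (f : Ω → DiffTwo d M) (p : (ℤ → Ω) × M) :
    TangentSpace (𝓡 d) p.2 →L[ℝ] TangentSpace (𝓡 d) (extSystem f p).2 :=
  mfderiv (𝓡 d) (𝓡 d) (f (p.1 0)) p.2

/-- The inverse `DG⁻¹` of the action on tangent vectors: at `p = (ω, x)` it is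
`D(f_{ω₋₁}⁻¹)(x)`. -/
def extTangentInv {d : ℕ} {Ω M : Type*} [TopologicalSpace M]
    [ChartedSpace (EuclideanSpace ℝ (Fin d)) M]
    (f : Ω → DiffTwo d M) (p : (ℤ → Ω) × M) :
    TangentSpace (𝓡 d) p.2 →L[ℝ] TangentSpace (𝓡 d) ((extSystem f).symm p).2 :=
  mfderiv (𝓡 d) (𝓡 d) (f (p.1 (-1))).symm p.2

/-- The iterate `DG^{-k}` at `p`, from the tangent space over `p` to the one over `G^{-k}(p)`. -/
def extTangentInvIter {d : ℕ} {Ω M : Type*} [TopologicalSpace M]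
    [ChartedSpace (EuclideanSpace ℝ (Fin d)) M] (f : Ω → DiffTwo d M) :
    (k : ℕ) → (p : (ℤ → Ω) × M) →
      (TangentSpace (𝓡 d) p.2 →L[ℝ] TangentSpace (𝓡 d) ((extSystem f).symm^[k] p).2)
  | 0, p => ContinuousLinearMap.id ℝ (TangentSpace (𝓡 d) p.2)
  | k + 1, p => (extTangentInvIter f k ((extSystem f).symm p)).comp (extTangentInv f p)

/-- `E` is a continuous sub-bundle of rank `r`, over the set `Λ`, of the tangent bundle of
`Ω^ℤ × M` (whose fibre over `(ω, x)` is `T_x M`): near every point of `Λ` it is spanned by a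
continuous frame of `r` linearly independent vector fields. -/
def IsContinuousSubbundle {d : ℕ} {Ω M : Type*} [TopologicalSpace Ω] [TopologicalSpace M]
    [ChartedSpace (EuclideanSpace ℝ (Fin d)) M] [IsManifold (𝓡 d) ∞ M]
    (Λ : Set ((ℤ → Ω) × M)) (r : ℕ)
    (E : (p : (ℤ → Ω) × M) → Submodule ℝ (TangentSpace (𝓡 d) p.2)) : Prop :=
  ∀ p ∈ Λ, ∃ U ∈ 𝓝[Λ] p, ∃ X : Fin r → (q : (ℤ → Ω) × M) → TangentSpace (𝓡 d) q.2,
    (∀ j, ContinuousOn (fun q => (⟨q.2, X j q⟩ : TangentBundle (𝓡 d) M)) U) ∧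
    ∀ q ∈ U, LinearIndependent ℝ (fun j => X j q) ∧ Submodule.span ℝ (Set.range fun j => X j q) = E q

/-- `E` is `DG`-invariant over `Λ`: `DG(E(p)) = E(G(p))` for every `p ∈ Λ`. -/
def IsInvariantSubbundle {d : ℕ} {Ω M : Type*} [TopologicalSpace M]
    [ChartedSpace (EuclideanSpace ℝ (Fin d)) M]
    (f : Ω → DiffTwo d M) (Λ : Set ((ℤ → Ω) × M))
    (E : (p : (ℤ → Ω) × M) → Submodule ℝ (TangentSpace (𝓡 d) p.2)) : Prop :=
  ∀ p ∈ Λ, (E p).map (extTangent f p).toLinearMap = E (extSystem f p)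

/-- The operator norm `‖A|_V‖`, for the Riemannian norms, of the restriction to a subspace
`V ⊆ T_x M` of a linear map `A : T_x M → T_y M`. -/
def restrictNorm {d : ℕ} {M : Type*} [TopologicalSpace M]
    [ChartedSpace (EuclideanSpace ℝ (Fin d)) M] [IsManifold (𝓡 d) ∞ M]
    [RiemannianBundle (fun x : M => TangentSpace (𝓡 d) x)] {x y : M}
    (A : TangentSpace (𝓡 d) x →L[ℝ] TangentSpace (𝓡 d) y)
    (V : Submodule ℝ (TangentSpace (𝓡 d) x)) : ℝ :=
  ‖A.comp V.subtypeL‖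

/-- The Pesin block `Λ^G_ℓ(E, α)`: the points `p ∈ Λ` such that
`∏_{i<n} ‖DG^{-ℓ}|_{E(G^{-iℓ}(p))}‖ ≤ exp(-α ℓ n)` for all `n`. -/
def pesinBlock {d : ℕ} {Ω M : Type*} [TopologicalSpace M]
    [ChartedSpace (EuclideanSpace ℝ (Fin d)) M] [IsManifold (𝓡 d) ∞ M]
    [RiemannianBundle (fun x : M => TangentSpace (𝓡 d) x)]
    (f : Ω → DiffTwo d M) (Λ : Set ((ℤ → Ω) × M))
    (E : (p : (ℤ → Ω) × M) → Submodule ℝ (TangentSpace (𝓡 d) p.2)) (ℓ : ℕ) (α : ℝ) :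
    Set ((ℤ → Ω) × M) :=
  {p ∈ Λ | ∀ n : ℕ,
    ∏ i ∈ Finset.range n,
      restrictNorm (extTangentInvIter f ℓ ((extSystem f).symm^[i * ℓ] p))
        (E ((extSystem f).symm^[i * ℓ] p)) ≤ Real.exp (-α * ℓ * n)}

/-- The ergodic component at `z` of a `T`-invariant probability measure `η`: the ergodic
decomposition of `η` is its disintegration along the σ-algebra of `T`-invariant measurable sets, and
the ergodic components are the conditional measures of that disintegration. They are determined for
`η`-almost every `z`. -/
def ergodicComponent {X : Type*} [MeasurableSpace X] [StandardBorelSpace X] (T : X → X)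
    (η : Measure X) [IsFiniteMeasure η] (z : X) : Measure X :=
  condExpKernel η (MeasurableSpace.invariants T) z

end

/-! Let φ = log‖DG|_E‖ and g = φ ∘ G⁻¹. Since E is a line field, norms along E multiply, so
‖DG^{-ℓ}|_{E(p)}‖ = exp(-S_ℓ g(p)), with Birkhoff sums S taken along G⁻¹. Thus p ∈ Λ lies in the
Pesin block iff S_{nℓ} g(p) ≥ αℓn for all n (`mem_pesinBlock_iff`).

Fix α < a < θ. Under η, the sums S_n(g - θ) are almost everywhere bounded below
(`ae_bddBelow_birkhoffSum`), so some ℓ makes η(S_ℓ g > ℓa) close to 1. With g replaced by a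
continuous extension, this set is open, and its measure stays close to 1 for η_k with k large. For
each such η_k, the maximal ergodic theorem applied to G^{-ℓ} and S_ℓ g - ℓα bounds the measure of
the complement of the block by (K + a)/(a - α) times η_k(S_ℓ g ≤ ℓa), where |g| ≤ K. This factor
does not depend on ℓ, so the required closeness to 1 can be fixed before ℓ is chosen. -/

/-! ### Birkhoff sums and the maximal ergodic theorem. -/

section ErgodicTheory

variable {X : Type*}

/-- The minimum of the Birkhoff sums `S₀ h, …, S_N h`. -/
def minBirkhoffSum (T : X → X) (h : X → ℝ) : ℕ → X → ℝ
  | 0, _ => 0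
  | N + 1, x => min 0 (h x + minBirkhoffSum T h N (T x))

theorem minBirkhoffSum_nonpos (T : X → X) (h : X → ℝ) (N : ℕ) (x : X) :
    minBirkhoffSum T h N x ≤ 0 := by
  cases N with
  | zero => exact le_rfl
  | succ N => exact min_le_left _ _

theorem minBirkhoffSum_succ_le (T : X → X) (h : X → ℝ) (N : ℕ) (x : X) :
    minBirkhoffSum T h (N + 1) x ≤ minBirkhoffSum T h N x := by
  induction N generalizing x with
  | zero => exact min_le_left _ _
  | succ N ih => exact min_le_min le_rfl (by linarith [ih (T x)])

theorem minBirkhoffSum_antitone (T : X → X) (h : X → ℝ) (x : X) :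
    Antitone fun N => minBirkhoffSum T h N x :=
  antitone_nat_of_succ_le fun N => minBirkhoffSum_succ_le T h N x

theorem minBirkhoffSum_le_birkhoffSum (T : X → X) (h : X → ℝ) (N : ℕ) (x : X) :
    minBirkhoffSum T h N x ≤ birkhoffSum T h N x := by
  induction N generalizing x with
  | zero => simp [minBirkhoffSum]
  | succ N ih =>
    rw [birkhoffSum_succ']
    exact (min_le_right _ _).trans (by linarith [ih (T x)])

theorem exists_birkhoffSum_eq_minBirkhoffSum (T : X → X) (h : X → ℝ) (N : ℕ) (x : X) :
    ∃ n, birkhoffSum T h n x = minBirkhoffSum T h N x := by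
  induction N generalizing x with
  | zero => exact ⟨0, by simp [minBirkhoffSum]⟩
  | succ N ih =>
    obtain ⟨n, hn⟩ := ih (T x)
    rcases min_choice 0 (h x + minBirkhoffSum T h N (T x)) with h0 | h0
    · exact ⟨0, by rw [minBirkhoffSum, h0, birkhoffSum_zero]⟩
    · exact ⟨n + 1, by rw [minBirkhoffSum, h0, birkhoffSum_succ', hn]⟩

theorem setOf_exists_birkhoffSum_neg (T : X → X) (h : X → ℝ) :
    {x | ∃ n, birkhoffSum T h n x < 0} = ⋃ N, {x | minBirkhoffSum T h N x < 0} := by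
  ext x
  simp only [Set.mem_ofPred_eq, Set.mem_iUnion]
  constructor
  · rintro ⟨n, hn⟩
    exact ⟨n, (minBirkhoffSum_le_birkhoffSum T h n x).trans_lt hn⟩
  · rintro ⟨N, hN⟩
    obtain ⟨n, hn⟩ := exists_birkhoffSum_eq_minBirkhoffSum T h N x
    exact ⟨n, hn ▸ hN⟩

/-- The Pesin condition only sees times divisible by ℓ; grouping into blocks turns it into a
condition on sums for `T^[ℓ]`. -/
theorem birkhoffSum_mul (T : X → X) (g : X → ℝ) (m n : ℕ) (x : X) :
    birkhoffSum T^[m] (birkhoffSum T g m) n x = birkhoffSum T g (n * m) x := by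
  induction n with
  | zero => simp
  | succ n ih =>
    rw [birkhoffSum_succ, ih, Nat.succ_mul, birkhoffSum_add, ← Function.iterate_mul, mul_comm m n]

theorem birkhoffSum_sub_const (T : X → X) (g : X → ℝ) (c : ℝ) (n : ℕ) (x : X) :
    birkhoffSum T (fun y => g y - c) n x = birkhoffSum T g n x - n * c := by
  simp [birkhoffSum, Finset.sum_sub_distrib]

variable [MeasurableSpace X] {μ : Measure X} {T : X → X} {h : X → ℝ}

theorem Measurable.birkhoffSum (hT : Measurable T) (hh : Measurable h) (n : ℕ) :
    Measurable (birkhoffSum T h n) :=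
  Finset.measurable_sum _ fun i _ => hh.comp (hT.iterate i)

theorem Measurable.minBirkhoffSum (hT : Measurable T) (hh : Measurable h) (N : ℕ) :
    Measurable (minBirkhoffSum T h N) := by
  induction N with
  | zero => exact measurable_const
  | succ N ih => exact measurable_const.min (hh.add (ih.comp hT))

theorem MeasureTheory.MeasurePreserving.integrable_minBirkhoffSum (hT : MeasurePreserving T μ μ)
    (hi : Integrable h μ) (N : ℕ) : Integrable (minBirkhoffSum T h N) μ := by
  induction N with
  | zero => exact integrable_zero _ _ _
  | succ N ih => exact (integrable_zero _ _ _).inf (hi.add (hT.integrable_comp_of_integrable ih))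

/-- The maximal ergodic theorem. -/
theorem MeasureTheory.MeasurePreserving.setIntegral_exists_birkhoffSum_neg_nonpos
    (hT : MeasurePreserving T μ μ) (hh : Measurable h) (hi : Integrable h μ) :
    ∫ x in {x | ∃ n, birkhoffSum T h n x < 0}, h x ∂μ ≤ 0 := by
  have hmeas : ∀ N, MeasurableSet {x | minBirkhoffSum T h N x < 0} := fun N =>
    measurableSet_lt (hT.measurable.minBirkhoffSum hh N) measurable_const
  have hmono : Monotone fun N => {x | minBirkhoffSum T h N x < 0} := fun N N' hN x hx =>
    (minBirkhoffSum_antitone T h x hN).trans_lt hx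
  rw [setOf_exists_birkhoffSum_neg]
  refine le_of_tendsto (tendsto_setIntegral_of_monotone hmeas hmono hi.integrableOn)
    (Eventually.of_forall fun N => ?_)
  have hm := hT.integrable_minBirkhoffSum hi N
  have hmT : Integrable (fun x => minBirkhoffSum T h N (T x)) μ :=
    hT.integrable_comp_of_integrable hm
  rw [← integral_indicator (hmeas N)]
  -- Garsia's argument: where the minimum m_N is negative, h = m_N - m_{N-1} ∘ T ≤ m_N - m_N ∘ T;
  -- elsewhere m_N = 0 and m_N ∘ T ≤ 0. The right side is a coboundary, of integral 0.
  calc ∫ x, {x | minBirkhoffSum T h N x < 0}.indicator h x ∂μ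
      ≤ ∫ x, (minBirkhoffSum T h N x - minBirkhoffSum T h N (T x)) ∂μ := by
        refine integral_mono (hi.indicator (hmeas N)) (hm.sub hmT) fun x => ?_
        by_cases hx : minBirkhoffSum T h N x < 0
        · rw [Set.indicator_of_mem (by exact hx)]
          cases N with
          | zero => exact absurd hx (lt_irrefl _)
          | succ N =>
            have h1 : minBirkhoffSum T h (N + 1) x = h x + minBirkhoffSum T h N (T x) := by
              rw [minBirkhoffSum] at hx ⊢
              exact min_eq_right ((min_lt_iff.1 hx).resolve_left (lt_irrefl _)).le
            have h2 := minBirkhoffSum_succ_le T h N (T x)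
            simp only
            linarith
        · rw [Set.indicator_of_notMem (by exact hx)]
          have := minBirkhoffSum_nonpos T h N (T x)
          simp only
          linarith
    _ = 0 := by
        rw [integral_sub hm hmT, sub_eq_zero]
        conv_lhs => rw [← hT.map_eq]
        exact integral_map hT.aemeasurable
          (hT.map_eq.symm ▸ hm.aestronglyMeasurable)

/-- If `h` is at least `c` on a large set, then most points have nonnegative Birkhoff sums. -/
theorem MeasureTheory.MeasurePreserving.measureReal_exists_birkhoffSum_neg_le
    [IsFiniteMeasure μ] (hT : MeasurePreserving T μ μ) (hh : Measurable h) {K c : ℝ}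
    (hi : Integrable h μ) (hK : ∀ x, -K ≤ h x) (hKc : 0 ≤ K + c) :
    c * μ.real {x | ∃ n, birkhoffSum T h n x < 0} ≤ (K + c) * μ.real {x | c ≤ h x}ᶜ := by
  set B := {x | ∃ n, birkhoffSum T h n x < 0}
  have hU : MeasurableSet {x | c ≤ h x}ᶜ := (measurableSet_le measurable_const hh).compl
  have h0 := hT.setIntegral_exists_birkhoffSum_neg_nonpos hh hi
  have hind : Integrable ({x | c ≤ h x}ᶜ.indicator fun _ => K + c) (μ.restrict B) :=
    (integrable_const _).indicator hU
  -- Pointwise h ≥ c - (K + c)·1_{h < c}, the right side being -K where h < c.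
  have h1 : ∫ x in B, (c - {x | c ≤ h x}ᶜ.indicator (fun _ => K + c) x) ∂μ ≤ ∫ x in B, h x ∂μ := by
    refine integral_mono ((integrable_const _).sub hind) hi.integrableOn fun x => ?_
    by_cases hx : c ≤ h x
    · simpa [Set.indicator_of_notMem (show x ∉ {x | c ≤ h x}ᶜ from fun h' => h' hx)] using hx
    · simpa [Set.indicator_of_mem (show x ∈ {x | c ≤ h x}ᶜ from hx)] using hK x
  rw [integral_sub (integrable_const _) hind, integral_indicator_const _ hU] at h1
  simp only [integral_const, smul_eq_mul, measureReal_restrict_apply MeasurableSet.univ,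
    measureReal_restrict_apply hU, Set.univ_inter] at h1
  have h2 : μ.real ({x | c ≤ h x}ᶜ ∩ B) ≤ μ.real {x | c ≤ h x}ᶜ :=
    measureReal_mono Set.inter_subset_left
  have h3 := mul_le_mul_of_nonneg_left h2 hKc
  linarith

/-- If the integral of `h` over each nonnull invariant set is positive, then almost all orbits have
Birkhoff sums that are bounded below. -/
theorem MeasureTheory.MeasurePreserving.ae_bddBelow_birkhoffSum
    (hT : MeasurePreserving T μ μ) (hh : Measurable h) (hi : Integrable h μ)
    (hpos : ∀ B, MeasurableSet B → T ⁻¹' B = B → μ B ≠ 0 → 0 < ∫ x in B, h x ∂μ) :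
    ∀ᵐ x ∂μ, ∃ C : ℕ, ∀ n, -(C : ℝ) ≤ birkhoffSum T h n x := by
  set B : Set X := {x | ∀ C : ℕ, ∃ n, birkhoffSum T h n x < -C}
  have hBm : MeasurableSet B := by
    have : B = ⋂ C : ℕ, ⋃ n, {x | birkhoffSum T h n x < -C} := by ext; simp [B]
    rw [this]
    exact MeasurableSet.iInter fun C => MeasurableSet.iUnion fun n =>
      measurableSet_lt (hT.measurable.birkhoffSum hh n) measurable_const
  -- Adding or removing the first term h x changes the sums by a fixed amount, absorbed by enlarging
  -- C by k.
  have hBinv : T ⁻¹' B = B := by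
    ext x
    constructor
    · intro hx C
      obtain ⟨k, hk⟩ := exists_nat_ge (h x)
      obtain ⟨n, hn⟩ := hx (C + k)
      refine ⟨n + 1, ?_⟩
      rw [birkhoffSum_succ']
      push_cast at hn
      linarith
    · intro hx C
      obtain ⟨k, hk⟩ := exists_nat_ge (-h x)
      obtain ⟨n, hn⟩ := hx (C + k)
      cases n with
      | zero =>
        rw [birkhoffSum_zero] at hn
        have : (0 : ℝ) ≤ ((C + k : ℕ) : ℝ) := Nat.cast_nonneg _
        linarith
      | succ n =>
        refine ⟨n, ?_⟩
        rw [birkhoffSum_succ'] at hn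
        push_cast at hn
        linarith
  have hB0 : μ B = 0 := by
    by_contra hne
    -- The maximal ergodic theorem for μ restricted to B gives ∫_B h ≤ 0, since every point of B has
    -- a negative sum (take C = 0).
    have hTB : MeasurePreserving T (μ.restrict B) (μ.restrict B) := by
      have := hT.restrict_preimage hBm
      rwa [hBinv] at this
    have h1 := hTB.setIntegral_exists_birkhoffSum_neg_nonpos hh hi.integrableOn
    have hsub : B ⊆ {x | ∃ n, birkhoffSum T h n x < 0} := fun x hx => by
      obtain ⟨n, hn⟩ := hx 0
      exact ⟨n, by simpa using hn⟩
    have hm : MeasurableSet {x | ∃ n, birkhoffSum T h n x < 0} := by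
      rw [Set.ofPred_exists]
      exact MeasurableSet.iUnion fun n =>
        measurableSet_lt (hT.measurable.birkhoffSum hh n) measurable_const
    rw [Measure.restrict_restrict hm, Set.inter_eq_self_of_subset_right hsub] at h1
    exact absurd (hpos B hBm hBinv hne) (not_lt.2 h1)
  filter_upwards [measure_eq_zero_iff_ae_notMem.1 hB0] with x hx
  simpa [B] using hx

/-- If the averages of `g` over the nonnull invariant sets are larger than `θ > a`, then for some
`ℓ` the Birkhoff average `S_ℓ g / ℓ` is larger than `a` with probability close to `1`. -/
theorem MeasureTheory.MeasurePreserving.exists_measure_birkhoffSum_gt [IsProbabilityMeasure μ]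
    (hT : MeasurePreserving T μ μ) {g : X → ℝ} (hg : Measurable g) (hi : Integrable g μ) {θ a : ℝ}
    (ha : a < θ)
    (hpos : ∀ B, MeasurableSet B → T ⁻¹' B = B → μ B ≠ 0 → θ * μ.real B < ∫ x in B, g x ∂μ)
    {δ : ENNReal} (hδ : δ < 1) :
    ∃ ℓ : ℕ, 0 < ℓ ∧ δ < μ {x | ℓ * a < birkhoffSum T g ℓ x} := by
  have hae := hT.ae_bddBelow_birkhoffSum (h := fun x => g x - θ) (hg.sub_const θ)
    (hi.sub (integrable_const θ)) fun B hB hTB hne => by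
      rw [integral_sub hi.integrableOn (integrable_const θ), integral_const,
        measureReal_restrict_apply MeasurableSet.univ, Set.univ_inter, smul_eq_mul, mul_comm]
      linarith [hpos B hB hTB hne]
  set D : ℕ → Set X := fun C => {x | ∀ n, -(C : ℝ) ≤ birkhoffSum T (fun x => g x - θ) n x}
  have hD : Monotone D := fun C C' hC x hx n =>
    (neg_le_neg (Nat.cast_le.2 hC)).trans (hx n)
  have hlim := tendsto_measure_iUnion_atTop (μ := μ) hD
  have hfull : μ (⋃ C, D C) = 1 := by
    rw [← measure_univ (μ := μ)]
    refine measure_congr (eventuallyEq_univ.2 ?_)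
    filter_upwards [hae] with x hx
    simpa [D] using hx
  rw [hfull] at hlim
  obtain ⟨C, hC⟩ := (hlim.eventually (lt_mem_nhds hδ)).exists
  -- On `D C` one has S_ℓ g ≥ ℓθ - C, which exceeds ℓa once ℓ > C/(θ - a).
  obtain ⟨ℓ, hℓ⟩ := exists_nat_gt (C / (θ - a))
  have hθa : 0 < θ - a := sub_pos.2 ha
  have hℓ0 : (0 : ℝ) < ℓ := (div_nonneg (Nat.cast_nonneg C) hθa.le).trans_lt hℓ
  refine ⟨ℓ, by exact_mod_cast hℓ0, hC.trans_le (measure_mono fun x hx => ?_)⟩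
  have h1 := hx ℓ
  rw [birkhoffSum_sub_const] at h1
  rw [div_lt_iff₀ hθa] at hℓ
  simp only [Set.mem_ofPred_eq]
  linarith

/-- Uniform estimate on the sets of points all whose `ℓ`-step Birkhoff sums grow at rate at least
`α`, along a weakly convergent sequence of invariant measures. -/
theorem exists_eventually_measureReal_birkhoffSum_ge [TopologicalSpace X] [OpensMeasurableSpace X]
    [HasOuterApproxClosed X]
    (hT : Continuous T) {g : X → ℝ} (hg : Continuous g) {K : ℝ} (hK : ∀ x, |g x| ≤ K)
    {η : ProbabilityMeasure X} (hη : MeasurePreserving T (η : Measure X) η) {θ α : ℝ} (hα : 0 < α)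
    (hαθ : α < θ)
    (hpos : ∀ B, MeasurableSet B → T ⁻¹' B = B → (η : Measure X) B ≠ 0 →
      θ * (η : Measure X).real B < ∫ x in B, g x ∂(η : Measure X))
    {ηs : ℕ → ProbabilityMeasure X}
    (hηs : ∀ n, MeasurePreserving T (ηs n : Measure X) (ηs n))
    (hlim : Tendsto ηs atTop (𝓝 η)) {ε : ℝ} (hε : 0 < ε) :
    ∃ ℓ : ℕ, 0 < ℓ ∧ ∀ᶠ k in atTop,
      (ηs k : Measure X).real {x | ∃ n : ℕ, birkhoffSum T g (n * ℓ) x < α * ℓ * n} ≤ ε := by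
  have hX : Nonempty X := nonempty_of_isProbabilityMeasure (η : Measure X)
  have hK0 : 0 ≤ K := (abs_nonneg _).trans (hK hX.some)
  have hint : ∀ ν : ProbabilityMeasure X, Integrable g (ν : Measure X) := fun ν =>
    Integrable.of_bound hg.measurable.aestronglyMeasurable K (Eventually.of_forall hK)
  obtain ⟨a, hαa, haθ⟩ := exists_between hαθ
  have ha0 : 0 < a - α := sub_pos.2 hαa
  have hKa : 0 < K + a := by linarith
  -- The size of exceptional set that the maximal inequality below amplifies to exactly ε.
  set r : ℝ := ε * (a - α) / (K + a) with hr
  have hr0 : 0 < r := by positivity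
  obtain ⟨ℓ, hℓ, hηℓ⟩ := hη.exists_measure_birkhoffSum_gt hg.measurable (hint η) haθ hpos
    (δ := 1 - ENNReal.ofReal r)
    (ENNReal.sub_lt_self ENNReal.one_ne_top one_ne_zero (ENNReal.ofReal_pos.2 hr0).ne')
  have hcont : Continuous (birkhoffSum T g ℓ) :=
    continuous_finsetSum _ fun i _ => hg.comp (hT.iterate i)
  have hopen : IsOpen {x | ℓ * a < birkhoffSum T g ℓ x} := isOpen_lt continuous_const hcont
  refine ⟨ℓ, hℓ, ?_⟩
  -- Portmanteau: the measure of an open set is lower semicontinuous under weak convergence.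
  filter_upwards [eventually_lt_of_lt_liminf (hηℓ.trans_le
    (ProbabilityMeasure.le_liminf_measure_open_of_tendsto hlim hopen))] with k hk
  set μ : Measure X := (ηs k : Measure X)
  have hℓ0 : (0 : ℝ) < ℓ := by exact_mod_cast hℓ
  have hcompl : μ.real {x | ℓ * a < birkhoffSum T g ℓ x}ᶜ ≤ r := by
    refine ENNReal.toReal_le_of_le_ofReal hr0.le ?_
    rw [prob_compl_eq_one_sub hopen.measurableSet]
    exact tsub_le_iff_tsub_le.1 hk.le
  set h : X → ℝ := fun x => birkhoffSum T g ℓ x - ℓ * α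
  have hsum : ∀ x, |birkhoffSum T g ℓ x| ≤ ℓ * K := fun x => by
    refine (Finset.abs_sum_le_sum_abs _ _).trans ?_
    simpa using Finset.sum_le_card_nsmul (Finset.range ℓ) (fun i => |g (T^[i] x)|) K
      fun i _ => hK _
  -- On the good set h exceeds c = ℓ(a - α), and h ≥ -ℓ(K + α) everywhere; ℓ cancels in the ratio of
  -- the two constants.
  have hmax := ((hηs k).iterate ℓ).measureReal_exists_birkhoffSum_neg_le (h := h)
    (K := ℓ * (K + α)) (c := ℓ * (a - α)) (hcont.sub continuous_const).measurable
    (Integrable.of_bound (hcont.sub continuous_const).measurable.aestronglyMeasurable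
      (ℓ * K + ‖ℓ * α‖) (Eventually.of_forall fun x =>
        (norm_sub_le _ _).trans (add_le_add_left (hsum x) _)))
    (fun x => by have := (abs_le.1 (hsum x)).1; simp only [h]; linarith) (by positivity)
  have hbad : {x | ∃ n : ℕ, birkhoffSum T g (n * ℓ) x < α * ℓ * n} =
      {x | ∃ n, birkhoffSum T^[ℓ] h n x < 0} := by
    ext x
    simp only [Set.mem_ofPred_eq, h]
    refine exists_congr fun n => ?_
    rw [birkhoffSum_sub_const, birkhoffSum_mul, sub_neg]
    ring_nf
  have hmono : μ.real {x | ℓ * (a - α) ≤ h x}ᶜ ≤ r := by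
    refine (measureReal_mono (Set.compl_subset_compl.2 fun x hx => ?_)).trans hcompl
    simp only [Set.mem_ofPred_eq, h] at hx ⊢
    linarith
  rw [hbad]
  have h1 := hmax.trans (mul_le_mul_of_nonneg_left hmono (by positivity))
  have h2 : (ℓ * (K + α) + ℓ * (a - α)) * r = ℓ * (a - α) * ε := by
    rw [hr]; field_simp; ring
  rw [h2] at h1
  exact le_of_mul_le_mul_left h1 (by positivity)

end ErgodicTheory

/-! ### Continuity of DG, and norms along E as Birkhoff sums. -/

section Geometry

variable {d : ℕ} {M Ω : Type*} [TopologicalSpace M] [ChartedSpace (EuclideanSpace ℝ (Fin d)) M]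

theorem iterate_extSystem_symm_mem {f : Ω → DiffTwo d M} {Λ : Set ((ℤ → Ω) × M)}
    (hGΛ : extSystem f '' Λ = Λ) {p : (ℤ → Ω) × M} (hp : p ∈ Λ) (k : ℕ) :
    (extSystem f).symm^[k] p ∈ Λ := by
  have h : Set.MapsTo (extSystem f).symm Λ Λ := fun q hq => by
    rw [← hGΛ] at hq
    obtain ⟨r, hr, rfl⟩ := hq
    rwa [Equiv.symm_apply_apply]
  exact h.iterate k hp

theorem span_singleton_eq_of_rank_one {p : (ℤ → Ω) × M} {V : Submodule ℝ (TangentSpace (𝓡 d) p.2)}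
    {X : Fin 1 → TangentSpace (𝓡 d) p.2} (hX : LinearIndependent ℝ X)
    (hV : Submodule.span ℝ (Set.range X) = V) : X 0 ≠ 0 ∧ V = Submodule.span ℝ {X 0} := by
  refine ⟨hX.ne_zero 0, ?_⟩
  rw [← hV, Set.range_unique]
  rfl

/-- The chain rule, stated in the total space because the base points g⁻¹(g x) and x are only
propositionally equal. -/
theorem tangentMap_symm_tangentMap [IsManifold (𝓡 d) ∞ M] (g : DiffTwo d M)
    (v : TangentBundle (𝓡 d) M) :
    tangentMap (𝓡 d) (𝓡 d) g.symm (tangentMap (𝓡 d) (𝓡 d) g v) = v := by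
  have h := tangentMap_comp_at v ((g.symm.mdifferentiable two_ne_zero) (g v.1))
    ((g.mdifferentiable two_ne_zero) v.1)
  rw [← h]
  have : (g.symm ∘ g : M → M) = id := by ext x; simp
  rw [this, tangentMap_id]; rfl

/-- The tangent maps of a `C²`-continuous family of diffeomorphisms are jointly continuous. They are
recovered from the second tangent maps by restriction to the zero section of `TTM`. -/
theorem continuous_tangentMap_family [IsManifold (𝓡 d) ∞ M] [TopologicalSpace Ω]
    {f : Ω → DiffTwo d M} (hf : Continuous f) :
    Continuous fun q : Ω × TangentBundle (𝓡 d) M => tangentMap (𝓡 d) (𝓡 d) (f q.1) q.2 := by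
  have : LocallyCompactSpace (TangentBundle (𝓡 d) M) :=
    Manifold.locallyCompact_of_finiteDimensional (𝓡 d).tangent
  -- Local compactness of TTM makes evaluation jointly continuous for the compact-open topology.
  have : LocallyCompactSpace (SecondTangentBundle d M) :=
    Manifold.locallyCompact_of_finiteDimensional (𝓡 d).tangent.tangent
  have h1 : Continuous fun w => secondTangentMap (f w) := continuous_induced_dom.comp hf
  have hz : Continuous (zeroSection (EuclideanSpace ℝ (Fin d) × EuclideanSpace ℝ (Fin d))
      (TangentSpace (𝓡 d).tangent : TangentBundle (𝓡 d) M → Type _)) :=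
    (contMDiff_zeroSection (n := 0) ℝ
      (TangentSpace (𝓡 d).tangent : TangentBundle (𝓡 d) M → Type _)
      (IB := (𝓡 d).tangent)).continuous
  have h2 : Continuous fun q : Ω × TangentBundle (𝓡 d) M => secondTangentMap (f q.1)
      (zeroSection (EuclideanSpace ℝ (Fin d) × EuclideanSpace ℝ (Fin d))
        (TangentSpace (𝓡 d).tangent : TangentBundle (𝓡 d) M → Type _) q.2) :=
    ContinuousEval.continuous_eval.comp ((h1.comp continuous_fst).prodMk (hz.comp continuous_snd))
  exact (FiberBundle.continuous_proj (EuclideanSpace ℝ (Fin d) × EuclideanSpace ℝ (Fin d))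
    (TangentSpace (𝓡 d).tangent : TangentBundle (𝓡 d) M → Type _)).comp h2

/-- Joint continuity of (ω, x) ↦ f_ω(x) comes from the tangent maps, restricted to the zero section
and projected to M. -/
theorem continuous_extSystem [IsManifold (𝓡 d) ∞ M] [TopologicalSpace Ω]
    {f : Ω → DiffTwo d M} (hf : Continuous f) : Continuous (extSystem f) := by
  have hz : Continuous (zeroSection (EuclideanSpace ℝ (Fin d))
      (TangentSpace (𝓡 d) : M → Type _)) :=
    (contMDiff_zeroSection (n := 0) ℝ (TangentSpace (𝓡 d) : M → Type _) (IB := (𝓡 d))).continuous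
  have h1 := (FiberBundle.continuous_proj (EuclideanSpace ℝ (Fin d))
    (TangentSpace (𝓡 d) : M → Type _)).comp ((continuous_tangentMap_family hf).comp
      (((continuous_apply (0 : ℤ)).comp continuous_fst).prodMk
        (hz.comp (continuous_snd (X := ℤ → Ω) (Y := M)))))
  exact Continuous.prodMk (continuous_pi fun i => (continuous_apply _).comp continuous_fst) h1

variable [IsManifold (𝓡 d) ∞ M]

theorem extTangent_ne_zero (f : Ω → DiffTwo d M) (p : (ℤ → Ω) × M)
    {v : TangentSpace (𝓡 d) p.2} (hv : v ≠ 0) : extTangent f p v ≠ 0 := by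
  intro h0
  have h1 := tangentMap_symm_tangentMap (f (p.1 0)) ⟨p.2, v⟩
  have h2 : tangentMap (𝓡 d) (𝓡 d) (f (p.1 0)) ⟨p.2, v⟩ = ⟨f (p.1 0) p.2, 0⟩ :=
    congrArg (TotalSpace.mk (f (p.1 0) p.2)) h0
  rw [h2] at h1
  have h3 : tangentMap (𝓡 d) (𝓡 d) (f (p.1 0)).symm ⟨f (p.1 0) p.2, 0⟩ =
      ⟨(f (p.1 0)).symm (f (p.1 0) p.2), 0⟩ :=
    congrArg (TotalSpace.mk _) (map_zero _)
  rw [h3] at h1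
  have h4 : ∀ (x : M), x = p.2 → (⟨x, 0⟩ : TangentBundle (𝓡 d) M) = ⟨p.2, v⟩ → v = 0 := by
    rintro x rfl h
    exact (TotalSpace.mk_inj.1 h).symm
  exact hv (h4 _ ((f (p.1 0)).symm_apply_apply p.2) h1)

theorem extTangentInv_extTangent (f : Ω → DiffTwo d M) (q : (ℤ → Ω) × M)
    (v : TangentSpace (𝓡 d) q.2) :
    (⟨((extSystem f).symm (extSystem f q)).2,
      extTangentInv f (extSystem f q) (extTangent f q v)⟩ : TangentBundle (𝓡 d) M) = ⟨q.2, v⟩ :=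
  tangentMap_symm_tangentMap (f (q.1 0)) ⟨q.2, v⟩

theorem IsContinuousSubbundle.exists_eq_span_singleton [TopologicalSpace Ω]
    {Λ : Set ((ℤ → Ω) × M)} {E : (p : (ℤ → Ω) × M) → Submodule ℝ (TangentSpace (𝓡 d) p.2)}
    (hE : IsContinuousSubbundle Λ 1 E) {p : (ℤ → Ω) × M} (hp : p ∈ Λ) :
    ∃ v : TangentSpace (𝓡 d) p.2, v ≠ 0 ∧ E p = Submodule.span ℝ {v} := by
  obtain ⟨U, hU, X, -, hX⟩ := hE p hp
  obtain ⟨hli, hsp⟩ := hX p (mem_of_mem_nhdsWithin hp hU)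
  exact ⟨X 0 p, span_singleton_eq_of_rank_one hli hsp⟩

theorem IsContinuousSubbundle.eq_span_singleton [TopologicalSpace Ω]
    {Λ : Set ((ℤ → Ω) × M)} {E : (p : (ℤ → Ω) × M) → Submodule ℝ (TangentSpace (𝓡 d) p.2)}
    (hE : IsContinuousSubbundle Λ 1 E) {p : (ℤ → Ω) × M} (hp : p ∈ Λ)
    {w : TangentSpace (𝓡 d) p.2} (hw : w ∈ E p) (hw0 : w ≠ 0) :
    E p = Submodule.span ℝ {w} := by
  obtain ⟨v, hv, hEp⟩ := hE.exists_eq_span_singleton hp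
  rw [hEp] at hw ⊢
  obtain ⟨c, rfl⟩ := Submodule.mem_span_singleton.1 hw
  have hc : c ≠ 0 := fun h => hw0 (by rw [h, zero_smul])
  exact (Submodule.span_singleton_smul_eq hc.isUnit v).symm

variable [RiemannianBundle (fun x : M => TangentSpace (𝓡 d) x)]

/-- On a line any nonzero vector realizes the operator norm; this is where rank one makes norms
multiplicative. -/
theorem restrictNorm_span_singleton {x y : M}
    (A : TangentSpace (𝓡 d) x →L[ℝ] TangentSpace (𝓡 d) y) {v : TangentSpace (𝓡 d) x}
    (hv : v ≠ 0) : restrictNorm A (Submodule.span ℝ {v}) = ‖A v‖ / ‖v‖ := by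
  have hv0 : 0 < ‖v‖ := norm_pos_iff.2 hv
  refine le_antisymm (ContinuousLinearMap.opNorm_le_bound _ (by positivity) ?_) ?_
  · rintro ⟨w, hw⟩
    obtain ⟨c, rfl⟩ := Submodule.mem_span_singleton.1 hw
    simp only [ContinuousLinearMap.comp_apply, Submodule.subtypeL_apply, map_smul, norm_smul,
      Submodule.coe_norm]
    field_simp
    exact le_rfl
  · rw [div_le_iff₀ hv0]
    exact (A.comp (Submodule.span ℝ {v}).subtypeL).le_opNorm
      ⟨v, Submodule.mem_span_singleton_self v⟩

/-- The logarithm of the expansion rate of `DG` along `E`. -/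
noncomputable def logExpansion (f : Ω → DiffTwo d M)
    (E : (p : (ℤ → Ω) × M) → Submodule ℝ (TangentSpace (𝓡 d) p.2)) (p : (ℤ → Ω) × M) : ℝ :=
  Real.log (restrictNorm (extTangent f p) (E p))

theorem norm_extTangent_eq (f : Ω → DiffTwo d M)
    (E : (p : (ℤ → Ω) × M) → Submodule ℝ (TangentSpace (𝓡 d) p.2)) {p : (ℤ → Ω) × M}
    {v : TangentSpace (𝓡 d) p.2} (hv : v ≠ 0) (hE : E p = Submodule.span ℝ {v}) :
    ‖extTangent f p v‖ = ‖v‖ * Real.exp (logExpansion f E p) := by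
  have hv0 : 0 < ‖v‖ := norm_pos_iff.2 hv
  have hw0 : 0 < ‖extTangent f p v‖ := norm_pos_iff.2 (extTangent_ne_zero f p hv)
  rw [logExpansion, hE, restrictNorm_span_singleton _ hv, Real.exp_log (by positivity)]
  field_simp

theorem continuous_norm_tangentBundle
    [IsContinuousRiemannianBundle (EuclideanSpace ℝ (Fin d)) (fun x : M => TangentSpace (𝓡 d) x)] :
    Continuous fun v : TangentBundle (𝓡 d) M => ‖v.2‖ := by
  have h : Continuous fun v : TangentBundle (𝓡 d) M => (inner ℝ v.2 v.2 : ℝ) :=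
    Continuous.inner_bundle (F := EuclideanSpace ℝ (Fin d)) (E := fun x : M => TangentSpace (𝓡 d) x)
      (b := fun v : TangentBundle (𝓡 d) M => v.1) (v := fun v => v.2) (w := fun v => v.2)
      continuous_id continuous_id
  refine (Real.continuous_sqrt.comp h).congr fun v => ?_
  exact (norm_eq_sqrt_real_inner v.2).symm

theorem continuousOn_norm_extTangent [TopologicalSpace Ω]
    [IsContinuousRiemannianBundle (EuclideanSpace ℝ (Fin d)) (fun x : M => TangentSpace (𝓡 d) x)]
    {f : Ω → DiffTwo d M} (hf : Continuous f) {U : Set ((ℤ → Ω) × M)}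
    {X : (q : (ℤ → Ω) × M) → TangentSpace (𝓡 d) q.2}
    (hX : ContinuousOn (fun q => (⟨q.2, X q⟩ : TangentBundle (𝓡 d) M)) U) :
    ContinuousOn (fun q => ‖extTangent f q (X q)‖) U := by
  have h1 : ContinuousOn (fun q : (ℤ → Ω) × M => (q.1 0, (⟨q.2, X q⟩ : TangentBundle (𝓡 d) M))) U :=
    ContinuousOn.prodMk ((continuous_apply (0 : ℤ)).comp continuous_fst).continuousOn hX
  have h2 := (continuous_tangentMap_family hf).comp_continuousOn h1
  exact (continuous_norm_tangentBundle.comp_continuousOn h2).congr fun q _ => rfl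

/-- For a local frame X of E, φ = log(‖DG X‖/‖X‖), and both norms are continuous and nonzero. -/
theorem IsContinuousSubbundle.continuousOn_logExpansion [TopologicalSpace Ω]
    [IsContinuousRiemannianBundle (EuclideanSpace ℝ (Fin d)) (fun x : M => TangentSpace (𝓡 d) x)]
    {f : Ω → DiffTwo d M} (hf : Continuous f)
    {Λ : Set ((ℤ → Ω) × M)} {E : (p : (ℤ → Ω) × M) → Submodule ℝ (TangentSpace (𝓡 d) p.2)}
    (hE : IsContinuousSubbundle Λ 1 E) : ContinuousOn (logExpansion f E) Λ := by
  intro p hp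
  obtain ⟨U, hU, X, hXc, hX⟩ := hE p hp
  have hpU := mem_of_mem_nhdsWithin hp hU
  have hne : ∀ q ∈ U, X 0 q ≠ 0 := fun q hq =>
    (span_singleton_eq_of_rank_one (hX q hq).1 (hX q hq).2).1
  have h1 : ContinuousOn (fun q => ‖X 0 q‖) U :=
    (continuous_norm_tangentBundle.comp_continuousOn (hXc 0)).congr fun q _ => rfl
  have h2 : ContinuousOn (fun q => ‖extTangent f q (X 0 q)‖) U :=
    continuousOn_norm_extTangent hf (hXc 0)
  have h3 : ContinuousOn (logExpansion f E) U := by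
    refine ((h2.div h1 fun q hq => norm_ne_zero_iff.2 (hne q hq)).log fun q hq => ?_).congr
      fun q hq => ?_
    · exact div_ne_zero (norm_ne_zero_iff.2 (extTangent_ne_zero f q (hne q hq)))
        (norm_ne_zero_iff.2 (hne q hq))
    · have := span_singleton_eq_of_rank_one (hX q hq).1 (hX q hq).2
      rw [logExpansion, this.2, restrictNorm_span_singleton _ this.1]
      rfl
  exact (h3 p hpU).mono_of_mem_nhdsWithin hU

/-- `DG⁻¹` maps the line `E p` to the line `E (G⁻¹ p)`, with the inverse of the expansion rate. -/
theorem extTangentInv_spec [TopologicalSpace Ω] {f : Ω → DiffTwo d M} {Λ : Set ((ℤ → Ω) × M)}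
    (hGΛ : extSystem f '' Λ = Λ) {E : (p : (ℤ → Ω) × M) → Submodule ℝ (TangentSpace (𝓡 d) p.2)}
    (hE : IsContinuousSubbundle Λ 1 E) (hEinv : IsInvariantSubbundle f Λ E) {p : (ℤ → Ω) × M}
    (hp : p ∈ Λ) {w : TangentSpace (𝓡 d) p.2} (hw : w ∈ E p) (hw0 : w ≠ 0) :
    (extSystem f).symm p ∈ Λ ∧ extTangentInv f p w ∈ E ((extSystem f).symm p) ∧
      extTangentInv f p w ≠ 0 ∧
      ‖extTangentInv f p w‖ = ‖w‖ * Real.exp (-logExpansion f E ((extSystem f).symm p)) := by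
  rw [← hGΛ] at hp
  obtain ⟨q, hq, rfl⟩ := hp
  rw [← hEinv q hq] at hw
  obtain ⟨v, hv, rfl⟩ := hw
  have hv0 : v ≠ 0 := by
    rintro rfl
    exact hw0 (map_zero _)
  have hnorm := norm_extTangent_eq f E hv0 (hE.eq_span_singleton hq hv hv0)
  -- G⁻¹(G q) is generalized to a variable r, so that r = q can be substituted in the dependent
  -- fibres.
  have key : ∀ (r : (ℤ → Ω) × M) (u : TangentSpace (𝓡 d) r.2), r = q →
      (⟨r.2, u⟩ : TangentBundle (𝓡 d) M) = ⟨q.2, v⟩ →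
      r ∈ Λ ∧ u ∈ E r ∧ u ≠ 0 ∧
        ‖u‖ = ‖extTangent f q v‖ * Real.exp (-logExpansion f E r) := by
    rintro r u rfl h
    obtain rfl := TotalSpace.mk_inj.1 h
    refine ⟨hq, hv, hv0, ?_⟩
    rw [hnorm, mul_assoc, ← Real.exp_add, add_neg_cancel, Real.exp_zero, mul_one]
  exact key _ _ ((extSystem f).symm_apply_apply q) (extTangentInv_extTangent f q v)

/-- DG⁻¹ at p undoes DG at G⁻¹(p), hence the observable φ ∘ G⁻¹. The image vector stays in E, so the
rates accumulate by induction. -/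
theorem norm_extTangentInvIter [TopologicalSpace Ω] {f : Ω → DiffTwo d M} {Λ : Set ((ℤ → Ω) × M)}
    (hGΛ : extSystem f '' Λ = Λ) {E : (p : (ℤ → Ω) × M) → Submodule ℝ (TangentSpace (𝓡 d) p.2)}
    (hE : IsContinuousSubbundle Λ 1 E) (hEinv : IsInvariantSubbundle f Λ E) (k : ℕ)
    {p : (ℤ → Ω) × M} (hp : p ∈ Λ) {w : TangentSpace (𝓡 d) p.2} (hw : w ∈ E p) (hw0 : w ≠ 0) :
    ‖extTangentInvIter f k p w‖ = ‖w‖ * Real.exp (-birkhoffSum (extSystem f).symm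
      (fun q => logExpansion f E ((extSystem f).symm q)) k p) := by
  induction k generalizing p with
  | zero =>
    rw [birkhoffSum_zero, neg_zero, Real.exp_zero, mul_one]
    rfl
  | succ k ih =>
    obtain ⟨h1, h2, h3, h4⟩ := extTangentInv_spec hGΛ hE hEinv hp hw hw0
    have h5 := ih h1 h2 h3
    rw [h4, mul_assoc, ← Real.exp_add, ← neg_add] at h5
    rw [birkhoffSum_succ']
    exact h5

theorem restrictNorm_extTangentInvIter [TopologicalSpace Ω] {f : Ω → DiffTwo d M}
    {Λ : Set ((ℤ → Ω) × M)} (hGΛ : extSystem f '' Λ = Λ)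
    {E : (p : (ℤ → Ω) × M) → Submodule ℝ (TangentSpace (𝓡 d) p.2)}
    (hE : IsContinuousSubbundle Λ 1 E) (hEinv : IsInvariantSubbundle f Λ E) (k : ℕ)
    {p : (ℤ → Ω) × M} (hp : p ∈ Λ) :
    restrictNorm (extTangentInvIter f k p) (E p) = Real.exp (-birkhoffSum (extSystem f).symm
      (fun q => logExpansion f E ((extSystem f).symm q)) k p) := by
  obtain ⟨v, hv, hEp⟩ := hE.exists_eq_span_singleton hp
  have h := norm_extTangentInvIter hGΛ hE hEinv k hp
    (hEp ▸ Submodule.mem_span_singleton_self v) hv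
  rw [hEp, restrictNorm_span_singleton _ hv, h]
  exact mul_div_cancel_left₀ _ (norm_ne_zero_iff.2 hv)

theorem mem_pesinBlock_iff [TopologicalSpace Ω] {f : Ω → DiffTwo d M}
    {Λ : Set ((ℤ → Ω) × M)} (hGΛ : extSystem f '' Λ = Λ)
    {E : (p : (ℤ → Ω) × M) → Submodule ℝ (TangentSpace (𝓡 d) p.2)}
    (hE : IsContinuousSubbundle Λ 1 E) (hEinv : IsInvariantSubbundle f Λ E) {ℓ : ℕ} {α : ℝ}
    {p : (ℤ → Ω) × M} (hp : p ∈ Λ) :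
    p ∈ pesinBlock f Λ E ℓ α ↔ ∀ n : ℕ, α * ℓ * n ≤ birkhoffSum (extSystem f).symm
      (fun q => logExpansion f E ((extSystem f).symm q)) (n * ℓ) p := by
  refine (and_iff_right hp).trans (forall_congr' fun n => ?_)
  rw [Finset.prod_congr rfl fun i _ => restrictNorm_extTangentInvIter hGΛ hE hEinv ℓ
    (iterate_extSystem_symm_mem hGΛ hp (i * ℓ)), ← Real.exp_sum, Real.exp_le_exp,
    ← birkhoffSum_mul, birkhoffSum, Finset.sum_neg_distrib]
  simp only [← Function.iterate_mul, mul_comm ℓ]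
  constructor <;> intro h <;> linarith

end Geometry

/-! ### Ergodic components and the conclusion. -/

/-- If the ergodic components of `μ` have mean larger than `θ`, then so do the invariant sets. -/
theorem lt_setIntegral_of_lt_integral_ergodicComponent {X : Type*} [MeasurableSpace X]
    [StandardBorelSpace X] {T : X → X} {μ : Measure X} [IsFiniteMeasure μ] {φ : X → ℝ}
    (hφ : Integrable φ μ) {θ : ℝ} (h : ∀ᵐ z ∂μ, θ < ∫ p, φ p ∂(ergodicComponent T μ z))
    {B : Set X} (hB : MeasurableSet B) (hTB : T ⁻¹' B = B) (hne : μ B ≠ 0) :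
    θ * μ.real B < ∫ x in B, φ x ∂μ := by
  have hle := MeasurableSpace.invariants_le T
  -- On invariant sets φ may be replaced by its conditional expectation, which is almost everywhere
  -- its mean over the ergodic component.
  rw [← setIntegral_condExp hle hφ (MeasurableSpace.measurableSet_invariants.2 ⟨hB, hTB⟩)]
  have hpos : ∀ᵐ x ∂μ, 0 < (μ[φ | MeasurableSpace.invariants T]) x - θ := by
    filter_upwards [h, condExp_ae_eq_integral_condExpKernel hle hφ] with x h1 h2
    rw [h2]
    exact sub_pos.2 h1
  have hint : Integrable (fun x => (μ[φ | MeasurableSpace.invariants T]) x - θ) (μ.restrict B) :=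
    (integrable_condExp.sub (integrable_const θ)).integrableOn
  have key : 0 < ∫ x in B, ((μ[φ | MeasurableSpace.invariants T]) x - θ) ∂μ := by
    have hpos' := ae_restrict_of_ae (s := B) hpos
    refine lt_of_le_of_ne (integral_nonneg_of_ae (hpos'.mono fun x hx => hx.le)) fun h0 => hne ?_
    have h1 := (integral_eq_zero_iff_of_nonneg_ae (hpos'.mono fun x hx => hx.le) hint).1 h0.symm
    have h2 : ∀ᵐ x ∂(μ.restrict B), False := by
      filter_upwards [hpos', h1] with x h3 h4
      exact h3.ne' h4
    rwa [eventually_false_iff_eq_bot, ae_eq_bot, Measure.restrict_eq_zero] at h2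
  rw [integral_sub integrable_condExp.integrableOn (integrable_const θ), integral_const,
    measureReal_restrict_apply MeasurableSet.univ, Set.univ_inter, smul_eq_mul] at key
  linarith



theorem mainTheorem10 {d : ℕ} {M Ω : Type*}
    -- a closed Riemannian manifold; the metric of `M` is only used for its topology
    [MetricSpace M] [CompactSpace M] [ChartedSpace (EuclideanSpace ℝ (Fin d)) M]
    [IsManifold (𝓡 d) ∞ M] [RiemannianBundle (fun x : M => TangentSpace (𝓡 d) x)]
    [IsContMDiffRiemannianBundle (𝓡 d) ∞ (EuclideanSpace ℝ (Fin d))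
      (fun x : M => TangentSpace (𝓡 d) x)]
    [MeasurableSpace M] [BorelSpace M]
    [MetricSpace Ω] [CompactSpace Ω] [MeasurableSpace Ω] [BorelSpace Ω]
    (f : Ω → DiffTwo d M) (hf : Continuous f)
    (Λ : Set ((ℤ → Ω) × M)) (hΛ : IsCompact Λ) (hGΛ : extSystem f '' Λ = Λ)
    (E : (p : (ℤ → Ω) × M) → Submodule ℝ (TangentSpace (𝓡 d) p.2))
    (hEcont : IsContinuousSubbundle Λ 1 E) (hEinv : IsInvariantSubbundle f Λ E)
    (η : ProbabilityMeasure ((ℤ → Ω) × M))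
    (hη : MeasurePreserving (extSystem f) (η : Measure ((ℤ → Ω) × M)) η)
    (hηΛ : (η : Measure ((ℤ → Ω) × M)) Λᶜ = 0)
    (θ α : ℝ) (hα : 0 < α) (hαθ : α < θ)
    (hexp : ∀ᵐ z ∂(η : Measure ((ℤ → Ω) × M)),
      θ < ∫ p, Real.log (restrictNorm (extTangent f p) (E p))
        ∂(ergodicComponent (extSystem f) (η : Measure ((ℤ → Ω) × M)) z))
    (ηs : ℕ → ProbabilityMeasure ((ℤ → Ω) × M))
    (hηs : ∀ n, Ergodic (extSystem f) (ηs n : Measure ((ℤ → Ω) × M)))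
    (hηsΛ : ∀ n, (ηs n : Measure ((ℤ → Ω) × M)) Λᶜ = 0)
    (hlim : Tendsto ηs atTop (𝓝 η)) (ε : ℝ) (hε : 0 < ε) :
    ∃ ℓ : ℕ, 0 < ℓ ∧
      1 - ε < liminf (fun n => (ηs n : Measure ((ℤ → Ω) × M)).real (pesinBlock f Λ E ℓ α)) atTop := by

  have : IsContinuousRiemannianBundle (EuclideanSpace ℝ (Fin d))
      (fun x : M => TangentSpace (𝓡 d) x) := by
    obtain ⟨g, hg, hgi⟩ := IsContMDiffRiemannianBundle.exists_contMDiff (IB := 𝓡 d) (n := ∞)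
      (F := EuclideanSpace ℝ (Fin d)) (E := fun x : M => TangentSpace (𝓡 d) x)
    exact ⟨g, hg.continuous, hgi⟩
  have hGc : Continuous (extSystem f) := continuous_extSystem hf
  -- A continuous bijection of a compact Hausdorff space is a homeomorphism.
  have hSc : Continuous (extSystem f).symm :=
    (Continuous.homeoOfEquivCompactToT2 (f := extSystem f) hGc).symm.continuous
  have hSmp : ∀ ν : ProbabilityMeasure ((ℤ → Ω) × M),
      MeasurePreserving (extSystem f) (ν : Measure ((ℤ → Ω) × M)) ν →
      MeasurePreserving (extSystem f).symm (ν : Measure ((ℤ → Ω) × M)) ν := fun ν hν =>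
    MeasurePreserving.symm ⟨extSystem f, hGc.measurable, hSc.measurable⟩ hν
  -- Tietze extension: φ is known to be continuous only on Λ, while weak convergence is tested on
  -- the whole space. All the measures are carried by Λ, so the choice of ψ off Λ is harmless.
  obtain ⟨ψ, hψ⟩ := ContinuousMap.exists_restrict_eq hΛ.isClosed
    ⟨Λ.domRestrict (logExpansion f E), (hEcont.continuousOn_logExpansion hf).domRestrict⟩
  have hψΛ : ∀ p ∈ Λ, logExpansion f E p = ψ p := fun p hp =>
    (congrArg (fun u : C(Λ, ℝ) => u ⟨p, hp⟩) hψ).symm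
  have hψint : Integrable ψ (η : Measure ((ℤ → Ω) × M)) :=
    Integrable.of_bound ψ.continuous.measurable.aestronglyMeasurable ‖ψ‖
      (Eventually.of_forall ψ.norm_coe_le_norm)
  have hae : logExpansion f E =ᵐ[(η : Measure ((ℤ → Ω) × M))] ψ := by
    filter_upwards [measure_eq_zero_iff_ae_notMem.1 hηΛ] with p hp
    exact hψΛ p (not_not.1 hp)
  obtain ⟨ℓ, hℓ, hev⟩ := exists_eventually_measureReal_birkhoffSum_ge hSc
    (g := fun p => ψ ((extSystem f).symm p)) (ψ.continuous.comp hSc) (K := ‖ψ‖)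
    (fun p => ψ.norm_coe_le_norm _) (hSmp η hη) hα hαθ
    (fun B hB hSB hne => by
      have hemb : MeasurableEmbedding (extSystem f).symm :=
        hSc.measurableEmbedding (extSystem f).symm.injective
      have hGB : extSystem f ⁻¹' B = B := by
        conv_lhs => rw [← hSB, ← Set.preimage_comp]
        simp
      -- By invariance of η and B, ψ ∘ G⁻¹ and ψ have the same integral over B.
      have h1 := (hSmp η hη).setIntegral_preimage_emb hemb ψ B
      rw [hSB] at h1
      rw [h1, ← setIntegral_congr_ae hB (hae.mono fun p hp _ => hp)]
      exact lt_setIntegral_of_lt_integral_ergodicComponent (hψint.congr hae.symm) hexp hB hGB hne)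
    (fun n => hSmp _ (hηs n).toMeasurePreserving) hlim (half_pos hε)
  refine ⟨ℓ, hℓ, ?_⟩
  -- The margin ε/2 keeps the inequality strict after passing to the liminf.
  have hlow : ∀ᶠ k in atTop,
      1 - ε / 2 ≤ (ηs k : Measure ((ℤ → Ω) × M)).real (pesinBlock f Λ E ℓ α) := by
    filter_upwards [hev] with k hk
    set bad : Set ((ℤ → Ω) × M) := {x | ∃ n : ℕ, birkhoffSum (extSystem f).symm
      (fun p => ψ ((extSystem f).symm p)) (n * ℓ) x < α * ℓ * n}
    have hcover : (Set.univ : Set ((ℤ → Ω) × M)) ⊆ pesinBlock f Λ E ℓ α ∪ (bad ∪ Λᶜ) := by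
      intro p _
      by_cases hp : p ∈ Λ
      · by_cases hb : p ∈ bad
        · exact Or.inr (Or.inl hb)
        · refine Or.inl ((mem_pesinBlock_iff hGΛ hEcont hEinv hp).2 fun n => ?_)
          have h1 := not_lt.1 fun h => hb ⟨n, h⟩
          refine h1.trans_eq (Finset.sum_congr rfl fun i _ => (hψΛ _ ?_).symm)
          rw [← Function.iterate_succ_apply' (extSystem f).symm]
          exact iterate_extSystem_symm_mem hGΛ hp _
      · exact Or.inr (Or.inr hp)
    have h1 := measureReal_mono (μ := (ηs k : Measure ((ℤ → Ω) × M))) hcover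
    have h2 := measureReal_union_le (μ := (ηs k : Measure ((ℤ → Ω) × M)))
      (pesinBlock f Λ E ℓ α) (bad ∪ Λᶜ)
    have h3 := measureReal_union_le (μ := (ηs k : Measure ((ℤ → Ω) × M))) bad Λᶜ
    have h4 : (ηs k : Measure ((ℤ → Ω) × M)).real Λᶜ = 0 := by
      rw [measureReal_def, hηsΛ k, ENNReal.toReal_zero]
    rw [probReal_univ] at h1
    linarith
  -- A real liminf is meaningful only with an upper bound, here the total mass 1.
  have hcob : IsCoboundedUnder (· ≥ ·) atTop fun k =>
      (ηs k : Measure ((ℤ → Ω) × M)).real (pesinBlock f Λ E ℓ α) :=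
    (isBoundedUnder_of ⟨1, fun k => measureReal_le_one⟩).isCoboundedUnder_ge
  exact (by linarith : 1 - ε < 1 - ε / 2).trans_le (le_liminf_of_le hcob hlow)
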